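/- Consider property graphs $G$ and queries $Q$ of the graph pattern calculus GPC. Queries are built from node and edge patterns, concatenation, union, conditioning and repetition $\pi^{n..m}$ ($0\le n\le m\le\infty$), qualified by restrictors (simple, trail, shortest, or shortest followed by simple or trail), optional path names and joins. The answers of a well-typed query $Q$ on $G$ form a set $[\![Q]\!]_G$ of pairs $(\bar p,\mu)$, where $\bar p$ is a tuple of paths (walks) in $G$ and $\mu$ is an assignment of values to variables; in repetitions, group variables collect lists of path/value pairs, consecutive edgeless paths being grouped together. The size of an input $(G,Q)$ is the number of symbols needed to write it down, where all numbers (ids, labels, keys, constants, variables, and the finite bounds $n,m$ of repetitions) are written in binary. The problem *Enumerate answers* asks, given $(G,Q)$ with $Q$ well-typed, to output all pairs $(\bar p,\mu)\in[\![Q]\!]_G$ without repetitions. It is to be solved by a deterministic Turing machine with a read-only input tape, finitely many work tapes and a write-only output tape, which halts after having written the answers one after the other, each followed by a separator; the space it uses is the number of cells used on the work tapes. **Theorem.** For every injective encoding of the inputs $(G,Q)$ over a finite alphabet, with code words of length polynomial in the size of $(G,Q)$, and every injective encoding of the answers over a finite alphabet, the following holds. There is no Turing machine that solves *Enumerate answers*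 and uses space bounded by a polynomial in the combined size of $G$ and $Q$. This is so even if the inputs are restricted to the pairs $(G_0,Q_k)$, $k\in\mathbb N$. Here $G_0$ is the graph with two nodes $u,v$, an $a$-edge and a $b$-edge from $u$ to $v$, and an $a$-edge and a $b$-edge from $v$ to $u$, and $Q_k$ is the (well-typed) query $$\mathsf{shortest}\ ()\,\rightarrow^{\{k..k\}}\,().$$ The number of distinct paths in the answers of $Q_k$ on $G_0$ is $2^{k+1}$. This is doubly exponential in the input size: there is an integer $c>0$ such that for all $k\in\mathbb N$ this number is at least $2^{2^{\lfloor s_k/c\rfloor}}$, where $s_k$ is the size of $(G_0,Q_k)$. -/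

import Mathlib

namespace GPC

/-! ### Property graphs -/

/-- Node ids, directed edge ids, undirected edge ids, labels, keys, constants and variables range
over countably infinite sets, all represented by the natural numbers; the constructors below keep
the different sorts of ids apart. -/
abbrev NodeId := ℕ
abbrev Label := ℕ
abbrev Key := ℕ
abbrev Const := ℕ
abbrev Var := ℕ

inductive EdgeId where
  | dir (i : ℕ)
  | undir (i : ℕ)

/-- Ids of graph elements: nodes, directed edges, undirected edges. -/
inductive ElemId where
  | node (n : NodeId)
  | edge (e : EdgeId)

/-- Membership of an id in `N ∪ D ∪ U`. -/
def IsElem (N D U : Finset ℕ) : ElemId → Prop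
  | .node n => n ∈ N
  | .edge (.dir e) => e ∈ D
  | .edge (.undir e) => e ∈ U

/-- Property graphs. As graphs are inputs of algorithms, every element has finitely many
properties. -/
structure PropertyGraph where
  nodes : Finset NodeId
  dirEdges : Finset ℕ
  undirEdges : Finset ℕ
  labels : {x : ElemId // IsElem nodes dirEdges undirEdges x} → Finset Label
  endpoints : {e // e ∈ undirEdges} → Finset {n // n ∈ nodes}
  card_endpoints : ∀ e, (endpoints e).card = 1 ∨ (endpoints e).card = 2
  src : {e // e ∈ dirEdges} → {n // n ∈ nodes}
  tgt : {e // e ∈ dirEdges} → {n // n ∈ nodes}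
  prop : {x : ElemId // IsElem nodes dirEdges undirEdges x} → Key → Option Const
  finite_prop : ∀ x, {a | prop x a ≠ none}.Finite

/-- A path `u₀ e₁ u₁ ⋯ eₙ uₙ`: its first node and the list `(e₁, u₁), …, (eₙ, uₙ)`. -/
structure Path where
  src : NodeId
  steps : List (EdgeId × NodeId)

namespace Path

def len (p : Path) : ℕ := p.steps.length

/-- The nodes `u₀, …, uₙ` of a path. -/
def nodes (p : Path) : List NodeId := p.src :: p.steps.map Prod.snd

/-- The edges `e₁, …, eₙ` of a path. -/
def edges (p : Path) : List EdgeId := p.steps.map Prod.fst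

/-- The last node `uₙ`. -/
def tgt (p : Path) : NodeId := (p.steps.map Prod.snd).getLastD p.src

def Concatenate (p q : Path) : Prop := p.tgt = q.src

/-- Concatenation `p · q`, meant for paths that concatenate. -/
def append (p q : Path) : Path := ⟨p.src, p.steps ++ q.steps⟩

/-- Concatenation `p₁ ⋯ pₙ` of a nonempty list of paths (the value on `[]` is never used). -/
def appendAll : List Path → Path
  | [] => ⟨0, []⟩
  | p :: l => l.foldl append p

end Path

/-! ### Syntax -/

/-- `x`, `:ℓ` or `x:ℓ`, or nothing at all. -/
structure Descriptor where
  var : Option Var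
  label : Option Label

inductive Direction where
  | forward
  | backward
  | undirected

/-- Conditions `x.a = c`, `x.a = y.b` and their Boolean combinations. -/
inductive Cond where
  | eqConst (x : Var) (a : Key) (c : Const)
  | eqProp (x : Var) (a : Key) (y : Var) (b : Key)
  | and (θ₁ θ₂ : Cond)
  | or (θ₁ θ₂ : Cond)
  | not (θ : Cond)

inductive Restrictor where
  | simple
  | trail
  | shortest
  | shortestSimple
  | shortestTrail

inductive Pattern where
  | node (d : Descriptor)
  | edge (dir : Direction) (d : Descriptor)
  | union (π₁ π₂ : Pattern)
  | concat (π₁ π₂ : Pattern)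
  | cond (π : Pattern) (θ : Cond)
  /-- `π{n..m}` with `0 ≤ n ≤ m ≤ ∞`. -/
  | rep (π : Pattern) (n : ℕ) (m : ℕ∞) (h : (n : ℕ∞) ≤ m)

inductive Query where
  /-- `ρ π` -/
  | pat (ρ : Restrictor) (π : Pattern)
  /-- `x = ρ π` -/
  | named (x : Var) (ρ : Restrictor) (π : Pattern)
  /-- `Q₁, Q₂` -/
  | join (Q₁ Q₂ : Query)

def Cond.vars : Cond → Finset Var
  | eqConst x _ _ => {x}
  | eqProp x _ y _ => {x, y}
  | and θ₁ θ₂ => θ₁.vars ∪ θ₂.vars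
  | or θ₁ θ₂ => θ₁.vars ∪ θ₂.vars
  | not θ => θ.vars

def Pattern.vars : Pattern → Finset Var
  | node d => d.var.toFinset
  | edge _ d => d.var.toFinset
  | union π₁ π₂ => π₁.vars ∪ π₂.vars
  | concat π₁ π₂ => π₁.vars ∪ π₂.vars
  | cond π θ => π.vars ∪ θ.vars
  | rep π _ _ _ => π.vars

def Query.vars : Query → Finset Var
  | pat _ π => π.vars
  | named x _ π => insert x π.vars
  | join Q₁ Q₂ => Q₁.vars ∪ Q₂.vars

/-! ### Type system -/

inductive Ty where
  | node
  | edge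
  | path
  | maybe (τ : Ty)
  | group (τ : Ty)

/-- `τ?`, which is `τ` if `τ` is a `maybe` type, and `maybe τ` otherwise. -/
def Ty.opt : Ty → Ty
  | maybe τ => maybe τ
  | τ => maybe τ

def Ty.IsSingleton (τ : Ty) : Prop := τ = node ∨ τ = edge

/-- `θ` has type `Bool` when the derivable typings of variables are given by `T`. -/
def Cond.IsBool (T : Var → Ty → Prop) : Cond → Prop
  | eqConst x _ _ => ∃ τ, T x τ ∧ τ.IsSingleton
  | eqProp x _ y _ => ∃ τ τ', T x τ ∧ T y τ' ∧ τ.IsSingleton ∧ τ'.IsSingleton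
  | and θ₁ θ₂ => θ₁.IsBool T ∧ θ₂.IsBool T
  | or θ₁ θ₂ => θ₁.IsBool T ∧ θ₂.IsBool T
  | not θ => θ.IsBool T

/-- `π ⊢ z : τ`. Each disjunct is a typing rule. -/
def Pattern.HasType : Pattern → Var → Ty → Prop
  | node d => fun z τ => d.var = some z ∧ τ = .node
  | edge _ d => fun z τ => d.var = some z ∧ τ = .edge
  | union π₁ π₂ => fun z τ =>
      (π₁.HasType z τ ∧ π₂.HasType z τ) ∨
      (∃ τ', τ = .maybe τ' ∧ π₁.HasType z τ' ∧ π₂.HasType z (.maybe τ')) ∨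
      (∃ τ', τ = .maybe τ' ∧ π₁.HasType z (.maybe τ') ∧ π₂.HasType z τ') ∨
      (∃ τ', τ = τ'.opt ∧ π₁.HasType z τ' ∧ z ∉ π₂.vars) ∨
      (∃ τ', τ = τ'.opt ∧ π₂.HasType z τ' ∧ z ∉ π₁.vars)
  | concat π₁ π₂ => fun z τ =>
      (π₁.HasType z τ ∧ π₂.HasType z τ ∧ τ.IsSingleton) ∨
      (π₁.HasType z τ ∧ z ∉ π₂.vars) ∨
      (π₂.HasType z τ ∧ z ∉ π₁.vars)
  | cond π θ => fun z τ => θ.IsBool π.HasType ∧ π.HasType z τ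
  | rep π _ _ _ => fun z τ => ∃ τ', τ = .group τ' ∧ π.HasType z τ'

/-- `Q ⊢ z : τ`. -/
def Query.HasType : Query → Var → Ty → Prop
  | pat _ π => fun z τ => π.HasType z τ
  | named x _ π => fun z τ =>
      (z = x ∧ τ = .path ∧ x ∉ π.vars) ∨ (z ≠ x ∧ π.HasType z τ)
  | join Q₁ Q₂ => fun z τ =>
      (Q₁.HasType z τ ∧ Q₂.HasType z τ ∧ τ.IsSingleton) ∨
      (Q₁.HasType z τ ∧ z ∉ Q₂.vars) ∨
      (Q₂.HasType z τ ∧ z ∉ Q₁.vars)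

/-- A query is well-typed if a type can be derived for each of its variables. -/
def Query.WellTyped (Q : Query) : Prop := ∀ x ∈ Q.vars, ∃ τ, Q.HasType x τ

/-! ### Values and assignments -/

inductive Value where
  | node (n : NodeId)
  | edge (e : EdgeId)
  | path (p : Path)
  | nothing
  | list (l : List (Path × Value))

/-- Partial functions from variables to values with finite domain. -/
def Assignment : Type := {μ : Var → Option Value // {x | μ x ≠ none}.Finite}

namespace Assignment

instance : CoeFun Assignment (fun _ => Var → Option Value) := ⟨Subtype.val⟩

/-- The empty assignment. -/
def empty : Assignment := ⟨fun _ => none, by simp⟩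

/-- The assignment with domain `D` that sends every variable in `D` to `v`. -/
def const (D : Finset Var) (v : Value) : Assignment :=
  ⟨fun x => if x ∈ D then some v else none, D.finite_toSet.subset (by intro x; simp)⟩

/-- The assignment `{x ↦ v}`, or the empty assignment if there is no variable `x`. -/
def single (x : Option Var) (v : Value) : Assignment := const x.toFinset v

/-- Two assignments unify if they agree on the intersection of their domains. -/
def Unify (μ μ' : Assignment) : Prop := ∀ x v v', μ x = some v → μ' x = some v' → v = v'

/-- `μ ∪ μ'`. -/
def union (μ μ' : Assignment) : Assignment :=
  ⟨fun x => (μ x).or (μ' x), (μ.2.union μ'.2).subset (by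
    intro x hx
    by_contra h
    simp only [Set.mem_union, Set.mem_ofPred_eq, not_or, not_not] at h
    exact hx (by simp [h.1, h.2]))⟩

/-- Union of a list of assignments. -/
def unionAll (l : List Assignment) : Assignment := l.foldr union empty

/-- Add the value `Nothing` for every variable of `D` that is not in the domain of `μ`. -/
def addNothing (D : Finset Var) (μ : Assignment) : Assignment := μ.union (const D .nothing)

end Assignment

/-! ### Semantics -/

namespace PropertyGraph

variable (G : PropertyGraph)

open Classical in
/-- `δ(v, a)`, which is undefined unless `v` is a node or an edge of the graph. -/
noncomputable def propOf (v : Value) (a : Key) : Option Const :=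
  match v with
  | .node n =>
      if h : IsElem G.nodes G.dirEdges G.undirEdges (.node n) then G.prop ⟨.node n, h⟩ a else none
  | .edge e =>
      if h : IsElem G.nodes G.dirEdges G.undirEdges (.edge e) then G.prop ⟨.edge e, h⟩ a else none
  | _ => none

/-- The element `x` carries the label `ℓ`, if `ℓ` is present. -/
def HasLabel (x : {x : ElemId // IsElem G.nodes G.dirEdges G.undirEdges x}) (ℓ : Option Label) :
    Prop := ∀ l ∈ ℓ, l ∈ G.labels x

end PropertyGraph

/-- `μ ⊨ θ`. -/
def Cond.Sat (G : PropertyGraph) (μ : Assignment) : Cond → Prop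
  | eqConst x a c => ∃ v, μ x = some v ∧ G.propOf v a = some c
  | eqProp x a y b =>
      ∃ v w c, μ x = some v ∧ μ y = some w ∧ G.propOf v a = some c ∧ G.propOf w b = some c
  | and θ₁ θ₂ => θ₁.Sat G μ ∧ θ₂.Sat G μ
  | or θ₁ θ₂ => θ₁.Sat G μ ∨ θ₂.Sat G μ
  | not θ => ¬ θ.Sat G μ

/-- The grouping of a sequence `(p₁, μ₁), …, (pₙ, μₙ)` that puts maximal runs of consecutive
edgeless paths into one block, every other path being a block of its own. -/
def blocks (l : List (Path × Assignment)) : List (List (Path × Assignment)) :=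
  l.splitBy fun a b => a.1.len == 0 && b.1.len == 0

/-- `collect((p₁, μ₁), …, (pₙ, μₙ))` is defined and equal to `μ`, where `D` is the common domain
of the `μᵢ`. It is defined if the assignments in each block unify pairwise, and then sends `x ∈ D`
to the list of the pairs `(p', μ' x)`, where `p'` is the concatenation of the paths of a block and
`μ'` the union of its assignments. -/
def IsCollect (D : Finset Var) (l : List (Path × Assignment)) (μ : Assignment) : Prop :=
  (∀ b ∈ blocks l, b.Pairwise fun a a' => a.2.Unify a'.2) ∧
  (∀ x ∉ D, μ x = none) ∧
  ∀ x ∈ D, ∃ vs : List (Path × Value), μ x = some (.list vs) ∧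
    List.Forall₂ (fun b v => v.1 = Path.appendAll (b.map Prod.fst) ∧
      Assignment.unionAll (b.map Prod.snd) x = some v.2) (blocks l) vs

/-- The `n`-th power of a set `S` of path/assignment pairs with domain `D`. -/
def power (G : PropertyGraph) (D : Finset Var) (S : Set (Path × Assignment)) (n : ℕ) :
    Set (Path × Assignment) :=
  if n = 0 then
    {a | ∃ u ∈ G.nodes, a = (⟨u, []⟩, Assignment.const D (.list []))}
  else
    {a | ∃ l : List (Path × Assignment), l.length = n ∧ (∀ b ∈ l, b ∈ S) ∧
      (l.map Prod.fst).IsChain Path.Concatenate ∧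
      a.1 = Path.appendAll (l.map Prod.fst) ∧ IsCollect D l a.2}

/-- The set of answers to a pattern. -/
def Pattern.sem (G : PropertyGraph) : Pattern → Set (Path × Assignment)
  | node d => {a | ∃ n : {n // n ∈ G.nodes}, G.HasLabel ⟨.node n, n.2⟩ d.label ∧
      a = (⟨n, []⟩, Assignment.single d.var (.node n))}
  | edge .forward d => {a | ∃ e : {e // e ∈ G.dirEdges},
      G.HasLabel ⟨.edge (.dir e), e.2⟩ d.label ∧
      a = (⟨G.src e, [(.dir e, G.tgt e)]⟩, Assignment.single d.var (.edge (.dir e)))}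
  | edge .backward d => {a | ∃ e : {e // e ∈ G.dirEdges},
      G.HasLabel ⟨.edge (.dir e), e.2⟩ d.label ∧
      a = (⟨G.tgt e, [(.dir e, G.src e)]⟩, Assignment.single d.var (.edge (.dir e)))}
  | edge .undirected d => {a | ∃ (e : {e // e ∈ G.undirEdges}) (u₁ u₂ : {n // n ∈ G.nodes}),
      G.endpoints e = {u₁, u₂} ∧ G.HasLabel ⟨.edge (.undir e), e.2⟩ d.label ∧
      a = (⟨u₁, [(.undir e, u₂)]⟩, Assignment.single d.var (.edge (.undir e)))}
  | concat π₁ π₂ => {a | ∃ a₁ ∈ π₁.sem G, ∃ a₂ ∈ π₂.sem G, a₁.1.Concatenate a₂.1 ∧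
      a₁.2.Unify a₂.2 ∧ a = (a₁.1.append a₂.1, a₁.2.union a₂.2)}
  | union π₁ π₂ => {a | ∃ b ∈ π₁.sem G ∪ π₂.sem G,
      a = (b.1, b.2.addNothing (π₁.vars ∪ π₂.vars))}
  | cond π θ => {a | a ∈ π.sem G ∧ θ.Sat G a.2}
  | rep π n m _ => {a | ∃ i : ℕ, n ≤ i ∧ (i : ℕ∞) ≤ m ∧ a ∈ power G π.vars (π.sem G) i}

def onlyTrail (S : Set (Path × Assignment)) : Set (Path × Assignment) :=
  {a | a ∈ S ∧ a.1.edges.Nodup}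

def onlySimple (S : Set (Path × Assignment)) : Set (Path × Assignment) :=
  {a | a ∈ S ∧ a.1.nodes.Nodup}

def onlyShortest (S : Set (Path × Assignment)) : Set (Path × Assignment) :=
  {a | a ∈ S ∧ ∀ b ∈ S, b.1.src = a.1.src → b.1.tgt = a.1.tgt → a.1.len ≤ b.1.len}

def Restrictor.restrict : Restrictor → Set (Path × Assignment) → Set (Path × Assignment)
  | simple, S => onlySimple S
  | trail, S => onlyTrail S
  | shortest, S => onlyShortest S
  | shortestSimple, S => onlyShortest (onlySimple S)
  | shortestTrail, S => onlyShortest (onlyTrail S)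

/-- An answer to a query: a tuple of paths and an assignment. -/
abbrev Answer := List Path × Assignment

/-- The set of answers to a query. -/
def Query.sem (G : PropertyGraph) : Query → Set Answer
  | pat ρ π => {A | ∃ a ∈ ρ.restrict (π.sem G), A = ([a.1], a.2)}
  | named x ρ π => {A | ∃ a ∈ ρ.restrict (π.sem G),
      A = ([a.1], a.2.union (Assignment.single (some x) (.path a.1)))}
  | join Q₁ Q₂ => {A | ∃ A₁ ∈ Q₁.sem G, ∃ A₂ ∈ Q₂.sem G,
      A₁.2.Unify A₂.2 ∧ A = (A₁.1 ++ A₂.1, A₁.2.union A₂.2)}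

/-! ### Size of the input -/

/-- Length of the binary notation of a number, followed by one delimiter. -/
def numSize (n : ℕ) : ℕ := n.size + 1

/-- Size of an optional number; an absent number has size `1`. -/
def optSize : Option ℕ → ℕ
  | none => 1
  | some n => numSize n

namespace PropertyGraph

variable (G : PropertyGraph)

/-- Size of the labels and properties of an element. -/
noncomputable def dataSize (x : {x : ElemId // IsElem G.nodes G.dirEdges G.undirEdges x}) : ℕ :=
  ∑ l ∈ G.labels x, numSize l +
    ∑ a ∈ (G.finite_prop x).toFinset, (numSize a + optSize (G.prop x a))

/-- Size of a graph: every id, label, key and constant is counted with its number of bits. -/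
noncomputable def size : ℕ :=
  ∑ n ∈ G.nodes.attach, (numSize n + G.dataSize ⟨.node n, n.2⟩) +
  ∑ e ∈ G.dirEdges.attach,
    (numSize e + numSize (G.src e) + numSize (G.tgt e) + G.dataSize ⟨.edge (.dir e), e.2⟩) +
  ∑ e ∈ G.undirEdges.attach,
    (numSize e + ∑ u ∈ G.endpoints e, numSize u + G.dataSize ⟨.edge (.undir e), e.2⟩)

end PropertyGraph

/-- Size of the upper bound of a repetition; `∞` has size `1`. -/
def boundSize (m : ℕ∞) : ℕ := if m = ⊤ then 1 else numSize m.toNat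

def Cond.size : Cond → ℕ
  | eqConst x a c => numSize x + numSize a + numSize c + 1
  | eqProp x a y b => numSize x + numSize a + numSize y + numSize b + 1
  | and θ₁ θ₂ => θ₁.size + θ₂.size + 1
  | or θ₁ θ₂ => θ₁.size + θ₂.size + 1
  | not θ => θ.size + 1

/-- Size of a pattern; the bounds of repetitions are written in binary. -/
def Pattern.size : Pattern → ℕ
  | node d => optSize d.var + optSize d.label + 1
  | edge _ d => optSize d.var + optSize d.label + 1
  | union π₁ π₂ => π₁.size + π₂.size + 1
  | concat π₁ π₂ => π₁.size + π₂.size + 1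
  | cond π θ => π.size + θ.size + 1
  | rep π n m _ => π.size + numSize n + boundSize m + 1

def Query.size : Query → ℕ
  | pat _ π => π.size + 1
  | named x _ π => numSize x + π.size + 1
  | join Q₁ Q₂ => Q₁.size + Q₂.size + 1

/-- The combined size of `G` and `Q`. -/
noncomputable def inputSize (G : PropertyGraph) (Q : Query) : ℕ := G.size + Q.size

/-! ### Turing machines with an output tape -/

/-- What the input head may scan: the left end marker, an input symbol, the right end marker. -/
inductive InputCell (Γ : Type) where
  | leftEnd
  | sym (a : Γ)
  | rightEnd

inductive Move where
  | left
  | stay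
  | right

/-- New position of a head on a tape with cells `0, 1, 2, …`; it cannot leave cell `0` to the
left. -/
def Move.apply : Move → ℕ → ℕ
  | left, i => i - 1
  | stay, i => i
  | right, i => i + 1

/-- One transition of a machine with `k` work tapes: new state, move on the input tape, symbols
written and moves on the work tapes, and at most one symbol appended to the output tape. -/
structure Action (State Work Δ : Type) (k : ℕ) where
  state : State
  inputMove : Move
  write : Fin k → Work
  workMove : Fin k → Move
  output : Option Δ

/-- Deterministic Turing machines with a read-only input tape (alphabet `Γ`), finitely many work
tapes, and a write-only output tape (alphabet `Δ`). The machine halts when `trans` is `none`. -/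
structure Machine (Γ Δ : Type) where
  State : Type
  finite_state : Finite State
  Work : Type
  finite_work : Finite Work
  blank : Work
  numTapes : ℕ
  start : State
  trans : State → InputCell Γ → (Fin numTapes → Work) → Option (Action State Work Δ numTapes)

namespace Machine

variable {Γ Δ : Type} (M : Machine Γ Δ)

structure Cfg where
  state : M.State
  inputPos : ℕ
  work : Fin M.numTapes → ℕ → M.Work
  workPos : Fin M.numTapes → ℕ
  output : List Δ

/-- The content of cell `i` of the input tape: cell `0` holds the left end marker, cells
`1, …, |w|` hold the input `w`, and cell `|w| + 1` holds the right end marker. -/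
def readInput (w : List Γ) (i : ℕ) : InputCell Γ :=
  if i = 0 then .leftEnd else
    match w[i - 1]? with
    | some a => .sym a
    | none => .rightEnd

def init : M.Cfg where
  state := M.start
  inputPos := 0
  work := fun _ _ => M.blank
  workPos := fun _ => 0
  output := []

/-- One step on input `w`; the input head cannot move past the right end marker. -/
def step (w : List Γ) (c : M.Cfg) : Option M.Cfg :=
  (M.trans c.state (readInput w c.inputPos) (fun j => c.work j (c.workPos j))).map fun a =>
    { state := a.state
      inputPos := min (a.inputMove.apply c.inputPos) (w.length + 1)
      work := fun j => Function.update (c.work j) (c.workPos j) (a.write j)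
      workPos := fun j => (a.workMove j).apply (c.workPos j)
      output := c.output ++ a.output.toList }

/-- On input `w` the machine can reach the configuration `c`. -/
def Reaches (w : List Γ) (c : M.Cfg) : Prop :=
  Relation.ReflTransGen (fun c₁ c₂ => M.step w c₁ = some c₂) M.init c

/-- On input `w` the machine halts with `o` on the output tape. -/
def HaltsWithOutput (w : List Γ) (o : List Δ) : Prop :=
  ∃ c, M.Reaches w c ∧ M.step w c = none ∧ c.output = o

/-- On input `w` the machine uses only the first `s` cells of each work tape. -/
def RunsInSpace (w : List Γ) (s : ℕ) : Prop :=
  ∀ c, M.Reaches w c → ∀ j, c.workPos j < s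

end Machine

/-! ### The problem of enumerating answers -/

/-- Encodings of the inputs as words over `Γ`: injective, and with words whose length is polynomial
in the size of the input. -/
structure InputEncoding (Γ : Type) where
  encode : PropertyGraph → Query → List Γ
  injective : ∀ G Q G' Q', encode G Q = encode G' Q' → G = G' ∧ Q = Q'
  length_le : ∃ p : Polynomial ℕ, ∀ G Q, (encode G Q).length ≤ p.eval (inputSize G Q)

/-- The output word for a sequence of answers, each of which is written as a word over `Δ` and
followed by the separator `none`. -/
def outputWord {Δ : Type} (encodeAnswer : Answer → List Δ) (l : List Answer) :
    List (Option Δ) :=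
  l.flatMap fun A => (encodeAnswer A).map some ++ [none]

/-- On every input in `I`, the machine halts and has written all answers, without repetitions, to
its output tape. -/
def EnumeratesOn {Γ Δ : Type} (I : Set (PropertyGraph × Query)) (enc : InputEncoding Γ)
    (encodeAnswer : Answer → List Δ) (M : Machine Γ (Option Δ)) : Prop :=
  ∀ G Q, (G, Q) ∈ I → ∃ l : List Answer, l.Nodup ∧ (∀ A, A ∈ l ↔ A ∈ Q.sem G) ∧
    M.HaltsWithOutput (enc.encode G Q) (outputWord encodeAnswer l)

/-- On the inputs in `I`, the space used on the work tapes is bounded by a polynomial in the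
combined size of the graph and the query. -/
def PolynomialSpaceOn {Γ Δ : Type} (I : Set (PropertyGraph × Query)) (enc : InputEncoding Γ)
    (M : Machine Γ Δ) : Prop :=
  ∃ p : Polynomial ℕ, ∀ G Q, (G, Q) ∈ I →
    M.RunsInSpace (enc.encode G Q) (p.eval (inputSize G Q))

/-- The inputs of the problem: all graphs with all well-typed queries. -/
def allInputs : Set (PropertyGraph × Query) := {x | x.2.WellTyped}

/-! ### A two-node graph and a family of queries -/

/-- The graph with nodes `0` and `1`, two edges from `0` to `1`, and two edges from `1` to `0`;
in both directions one edge has the label `0` and the other one has the label `1`. -/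
def twoNodeGraph : PropertyGraph where
  nodes := {0, 1}
  dirEdges := {0, 1, 2, 3}
  undirEdges := ∅
  labels := fun x => match x.1 with
    | .edge (.dir e) => {e % 2}
    | _ => ∅
  endpoints := fun _ => ∅
  card_endpoints := fun e => absurd e.2 (Finset.notMem_empty _)
  src := fun e => if e.1 < 2 then ⟨0, by simp⟩ else ⟨1, by simp⟩
  tgt := fun e => if e.1 < 2 then ⟨1, by simp⟩ else ⟨0, by simp⟩
  prop := fun _ _ => none
  finite_prop := fun _ => by simp

/-- The query `shortest () →{k..k} ()`. -/
def walkQuery (k : ℕ) : Query :=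
  .pat .shortest
    (.concat (.concat (.node ⟨none, none⟩) (.rep (.edge .forward ⟨none, none⟩) k k le_rfl))
      (.node ⟨none, none⟩))

/-- The inputs consisting of the two-node graph and one of these queries. -/
def walkInputs : Set (PropertyGraph × Query) := {x | ∃ k, x = (twoNodeGraph, walkQuery k)}

/-- The set of paths (one-element path tuples) returned by `walkQuery k` on the two-node graph. -/
def walkPaths (k : ℕ) : Set (List Path) := {P | ∃ μ, (P, μ) ∈ (walkQuery k).sem twoNodeGraph}

end GPC

namespace GPC

/-! ### Walks in the two-node graph -/

/-! The output alone is too long for polynomial space. A walk in the two-node graph is determined by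
its start node and the word of labels along its edges, and every such choice is possible. All
matches of the pattern have length `k`, so `shortest` discards none, and there are `2 ^ (k + 1)`
answers (`sem_walkQuery`, `ncard_walkPaths`). The number `k` enters the input only through its
binary notation, twice (`inputSize_walkQuery`), which makes this count doubly exponential in the
input size.

On the machine side, the output tape is write-only, so a configuration without its output determines
the rest of the computation. If such a reduced configuration recurred, the deterministic machine
would not halt. In space `s` on an input of length `n`, the running time, and hence the output
length, is therefore at most the number of reduced configurations
(`Machine.length_le_card_boundedCore`), which is at most 2 to a power polynomial in `n` and `s`
(`Machine.card_boundedCore_le`).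

Each answer occupies at least one output symbol, its separator. For `k = 2 ^ m` the input size is
linear in `m`, so polynomial space would give `2 ^ m + 1 ≤ R(m)` for a fixed polynomial `R` and all
`m`, which is impossible. -/

theorem Assignment.const_empty (v : Value) : Assignment.const ∅ v = Assignment.empty :=
  Subtype.ext (by funext x; simp [Assignment.const, Assignment.empty])

theorem Assignment.single_none (v : Value) : Assignment.single none v = Assignment.empty :=
  Assignment.const_empty v

theorem Assignment.empty_union_empty :
    Assignment.empty.union Assignment.empty = Assignment.empty :=
  Subtype.ext (by funext x; simp [Assignment.union, Assignment.empty])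

theorem Assignment.empty_unify (μ : Assignment) : Assignment.empty.Unify μ := by
  intro x v v' h
  simp [Assignment.empty] at h

theorem Assignment.unify_empty (μ : Assignment) : μ.Unify Assignment.empty := by
  intro x v v' _ h
  simp [Assignment.empty] at h

/-- Closed form of the fold in `Path.appendAll`. No matching of endpoints is needed, as `append`
keeps the first source and joins the step lists. -/
theorem Path.foldl_append (l : List Path) (p : Path) :
    l.foldl Path.append p = ⟨p.src, p.steps ++ l.flatMap Path.steps⟩ := by
  induction l generalizing p with
  | nil => simp
  | cons q l ih => simp [ih, Path.append]

theorem toNat_injective {u v : Bool} (h : u.toNat = v.toNat) : u = v := by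
  cases u <;> cases v <;> simp_all

/-- The one-edge path from node `u` along the edge with label `b`. -/
def edgePath (u b : Bool) : Path :=
  ⟨u.toNat, [(.dir (2 * u.toNat + b.toNat), (!u).toNat)]⟩

/-- The consecutive one-edge paths of the walk from `u` along edges with labels `l`. -/
def edgePaths : Bool → List Bool → List Path
  | _, [] => []
  | u, b :: l => edgePath u b :: edgePaths (!u) l

/-- The walk from `u` along edges with labels `l`. -/
def walk (u : Bool) (l : List Bool) : Path := ⟨u.toNat, (edgePaths u l).flatMap Path.steps⟩

theorem length_edgePaths (u : Bool) (l : List Bool) : (edgePaths u l).length = l.length := by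
  induction l generalizing u with
  | nil => rfl
  | cons b l ih => simp [edgePaths, ih]

theorem steps_walk_cons (u b : Bool) (l : List Bool) :
    (walk u (b :: l)).steps =
      (.dir (2 * u.toNat + b.toNat), (!u).toNat) :: (walk (!u) l).steps := rfl

theorem len_walk (u : Bool) (l : List Bool) : (walk u l).len = l.length := by
  induction l generalizing u with
  | nil => rfl
  | cons b l ih =>
    have := ih (!u)
    simp only [Path.len] at this ⊢
    rw [steps_walk_cons, List.length_cons, this, List.length_cons]

/-- Provides the match of the closing node pattern `()`. -/
theorem exists_tgt_walk (u : Bool) (l : List Bool) : ∃ v : Bool, (walk u l).tgt = v.toNat := by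
  induction l generalizing u with
  | nil => exact ⟨u, rfl⟩
  | cons b l ih =>
    obtain ⟨v, hv⟩ := ih (!u)
    refine ⟨v, ?_⟩
    rw [← hv]
    simp only [Path.tgt]
    rw [steps_walk_cons, List.map_cons, List.getLastD_cons]
    rfl

/-- Once the current node `u` is known, the edge id `2u + b` reveals the label `b`. The nodes
alternate, so the induction runs over all start nodes. -/
theorem steps_walk_injective (u : Bool) : Function.Injective fun l => (walk u l).steps := by
  intro l
  induction l generalizing u with
  | nil =>
    intro l' h
    cases l' with
    | nil => rfl
    | cons b l' => simp [walk, edgePaths, edgePath] at h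
  | cons b l ih =>
    intro l' h
    cases l' with
    | nil => simp [walk, edgePaths, edgePath] at h
    | cons b' l' =>
      simp only [steps_walk_cons, List.cons.injEq, Prod.mk.injEq, EdgeId.dir.injEq,
        Nat.add_left_cancel_iff, and_true] at h
      rw [ih _ h.2, toNat_injective h.1]

theorem walk_injective : Function.Injective fun x : Bool × List Bool => walk x.1 x.2 := by
  rintro ⟨u, l⟩ ⟨u', l'⟩ h
  have h : walk u l = walk u' l' := h
  obtain rfl : u = u' := toNat_injective (congrArg Path.src h)
  rw [steps_walk_injective u (congrArg Path.steps h)]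

/-! ### Semantics of the walk queries -/

theorem mem_nodes_twoNodeGraph (n : ℕ) : n ∈ twoNodeGraph.nodes ↔ ∃ u : Bool, n = u.toNat := by
  simp [twoNodeGraph]

theorem hasLabel_none (G : PropertyGraph)
    (x : {x : ElemId // IsElem G.nodes G.dirEdges G.undirEdges x}) : G.HasLabel x none := by
  intro l h
  simp at h

theorem sem_node_twoNodeGraph :
    (Pattern.node ⟨none, none⟩).sem twoNodeGraph =
      {a | ∃ u : Bool, a = (⟨u.toNat, []⟩, Assignment.empty)} := by
  ext a
  simp only [Pattern.sem, Set.mem_ofPred_eq, hasLabel_none, true_and, Assignment.single_none]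
  constructor
  · rintro ⟨⟨n, hn⟩, rfl⟩
    obtain ⟨u, rfl⟩ := (mem_nodes_twoNodeGraph n).mp hn
    exact ⟨u, rfl⟩
  · rintro ⟨u, rfl⟩
    exact ⟨⟨u.toNat, (mem_nodes_twoNodeGraph _).mpr ⟨u, rfl⟩⟩, rfl⟩

/-- The numbering in `edgePath` is that of the graph: edge `2u + b` leaves node `u` and ends in the
other node, so the four choices of `u` and `b` give the edges `0, 1, 2, 3`. -/
theorem sem_edge_twoNodeGraph :
    (Pattern.edge .forward ⟨none, none⟩).sem twoNodeGraph =
      {a | ∃ u b : Bool, a = (edgePath u b, Assignment.empty)} := by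
  ext a
  simp only [Pattern.sem, Set.mem_ofPred_eq, hasLabel_none, true_and, Assignment.single_none]
  constructor
  · rintro ⟨⟨e, he⟩, rfl⟩
    have he' : e = 0 ∨ e = 1 ∨ e = 2 ∨ e = 3 := by simpa [twoNodeGraph] using he
    rcases he' with rfl | rfl | rfl | rfl
    · exact ⟨false, false, rfl⟩
    · exact ⟨false, true, rfl⟩
    · exact ⟨true, false, rfl⟩
    · exact ⟨true, true, rfl⟩
  · rintro ⟨u, b, rfl⟩
    refine ⟨⟨2 * u.toNat + b.toNat, ?_⟩, ?_⟩
    · cases u <;> cases b <;> simp [twoNodeGraph]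
    · cases u <;> cases b <;> rfl

theorem isChain_edgePaths (u : Bool) (l : List Bool) :
    (edgePaths u l).IsChain Path.Concatenate := by
  induction l generalizing u with
  | nil => exact List.IsChain.nil
  | cons b l ih =>
    cases l with
    | nil => exact List.IsChain.singleton _
    | cons b' l => exact List.IsChain.cons_cons rfl (ih (!u))

/-- Every edge leads to the other node, so the concatenation condition forces the source of each
next edge and leaves only its label free. -/
theorem eq_edgePaths_of_isChain (u b : Bool) (l : List Path)
    (h : ∀ p ∈ l, ∃ v c, p = edgePath v c) (hl : (edgePath u b :: l).IsChain Path.Concatenate) :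
    ∃ bs, edgePath u b :: l = edgePaths u (b :: bs) := by
  induction l generalizing u b with
  | nil => exact ⟨[], rfl⟩
  | cons p l ih =>
    obtain ⟨v, c, rfl⟩ := h p (by simp)
    rw [List.isChain_cons_cons] at hl
    obtain rfl : (!u) = v := toNat_injective hl.1
    obtain ⟨bs, hbs⟩ := ih (!u) c (fun q hq => h q (by simp [hq])) hl.2
    refine ⟨c :: bs, ?_⟩
    rw [hbs]
    rfl

/-- Without variables there is nothing to collect, and empty assignments always unify, so `collect`
is defined whatever the blocks are. -/
theorem isCollect_empty_iff {l : List (Path × Assignment)}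
    (hl : ∀ a ∈ l, a.2 = Assignment.empty) (μ : Assignment) :
    IsCollect ∅ l μ ↔ μ = Assignment.empty := by
  constructor
  · rintro ⟨-, h, -⟩
    exact Subtype.ext (by funext x; exact h x (by simp))
  · rintro rfl
    refine ⟨fun b hb => ?_, fun x _ => rfl, by simp⟩
    refine List.pairwise_of_forall_mem_list fun a ha a' _ => ?_
    -- Flattening the blocks gives back `l`, so the members of a block are members of `l`.
    have : a ∈ (blocks l).flatten := List.mem_flatten.mpr ⟨b, hb, ha⟩
    rw [blocks, List.flatten_splitBy] at this
    rw [hl a this]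
    exact Assignment.empty_unify _

theorem power_edge_twoNodeGraph (k : ℕ) :
    power twoNodeGraph ∅ {a | ∃ u b : Bool, a = (edgePath u b, Assignment.empty)} k =
      {a | ∃ u l, l.length = k ∧ a = (walk u l, Assignment.empty)} := by
  ext ⟨p, μ⟩
  rcases Nat.eq_zero_or_pos k with rfl | hk
  -- The zeroth power has its own clause: one edgeless path per node, that is, the walks along the
  -- empty word.
  · simp only [power, if_true, Set.mem_ofPred_eq, Assignment.const_empty, List.length_eq_zero_iff]
    constructor
    · rintro ⟨n, hn, h⟩
      obtain ⟨u, rfl⟩ := (mem_nodes_twoNodeGraph n).mp hn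
      exact ⟨u, [], rfl, h⟩
    · rintro ⟨u, _, rfl, h⟩
      exact ⟨u.toNat, (mem_nodes_twoNodeGraph _).mpr ⟨u, rfl⟩, h⟩
  · simp only [power, hk.ne', if_false, Set.mem_ofPred_eq]
    constructor
    · rintro ⟨l, hlen, hmem, hchain, rfl, hcol⟩
      have hemp : ∀ a ∈ l, a.2 = Assignment.empty := fun a ha => by
        obtain ⟨u, b, rfl⟩ := hmem a ha
        rfl
      rw [isCollect_empty_iff hemp] at hcol
      subst hcol
      cases l with
      | nil => simp at hlen; omega
      | cons a l =>
        obtain ⟨u, b, rfl⟩ := hmem a (by simp)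
        obtain ⟨bs, hbs⟩ := eq_edgePaths_of_isChain u b (l.map Prod.fst) (by
          intro p hp
          obtain ⟨a, ha, rfl⟩ := List.mem_map.mp hp
          obtain ⟨v, c, rfl⟩ := hmem a (by simp [ha])
          exact ⟨v, c, rfl⟩) hchain
        refine ⟨u, b :: bs, ?_, ?_⟩
        · rw [← length_edgePaths u, ← hbs, ← hlen]
          simp
        · rw [walk, ← hbs]
          simp [Path.appendAll, Path.foldl_append, edgePath]
    · rintro ⟨u, bs, hlen, h⟩
      obtain ⟨rfl, rfl⟩ := Prod.mk.inj h
      have hfst : ((edgePaths u bs).map fun p => (p, Assignment.empty)).map Prod.fst =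
          edgePaths u bs := by
        simp [Function.comp_def]
      refine ⟨(edgePaths u bs).map fun p => (p, Assignment.empty), ?_, ?_, ?_, ?_, ?_⟩
      · rw [List.length_map, length_edgePaths, hlen]
      · clear hlen h hfst
        induction bs generalizing u with
        | nil => simp [edgePaths]
        | cons b bs ih =>
          simp only [edgePaths, List.map_cons, List.mem_cons]
          rintro a (rfl | ha)
          · exact ⟨u, b, rfl⟩
          · exact ih _ a ha
      · rw [hfst]
        exact isChain_edgePaths u bs
      · rw [hfst]
        cases bs with
        | nil => simp at hlen; omega
        | cons b bs => simp [walk, edgePaths, Path.appendAll, Path.foldl_append, edgePath]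
      · exact (isCollect_empty_iff (by simp) _).mpr rfl

/-- Unfolds a single layer of `Pattern.sem`, so that the subpatterns remain available for rewriting.
-/
theorem Pattern.sem_concat (G : PropertyGraph) (π₁ π₂ : Pattern) :
    (Pattern.concat π₁ π₂).sem G =
      {a | ∃ a₁ ∈ π₁.sem G, ∃ a₂ ∈ π₂.sem G, a₁.1.Concatenate a₂.1 ∧
        a₁.2.Unify a₂.2 ∧ a = (a₁.1.append a₂.1, a₁.2.union a₂.2)} := by
  rw [Pattern.sem]

/-- The outer node patterns contribute only edgeless paths and empty assignments, so they are
neutral for concatenation. -/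
theorem sem_walkPattern (k : ℕ) :
    (Pattern.concat (.concat (.node ⟨none, none⟩)
      (.rep (.edge .forward ⟨none, none⟩) k k le_rfl)) (.node ⟨none, none⟩)).sem twoNodeGraph =
      {a | ∃ u l, l.length = k ∧ a = (walk u l, Assignment.empty)} := by
  have hrep : (Pattern.rep (.edge .forward ⟨none, none⟩) k k le_rfl).sem twoNodeGraph =
      {a | ∃ u l, l.length = k ∧ a = (walk u l, Assignment.empty)} := by
    rw [← power_edge_twoNodeGraph, ← sem_edge_twoNodeGraph]
    ext a
    simp only [Pattern.sem, Set.mem_ofPred_eq, Nat.cast_le]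
    constructor
    · rintro ⟨i, h₁, h₂, h⟩
      obtain rfl := le_antisymm h₁ h₂
      exact h
    · exact fun h => ⟨k, le_rfl, le_rfl, h⟩
  ext a
  rw [Pattern.sem_concat, Pattern.sem_concat, hrep, sem_node_twoNodeGraph]
  constructor
  · rintro ⟨_, ⟨_, ⟨u, rfl⟩, _, ⟨v, l, hl, rfl⟩, h₁, -, rfl⟩, _, ⟨w, rfl⟩, h₂, -, rfl⟩
    obtain rfl : u = v := toNat_injective h₁
    exact ⟨u, l, hl, by simp [Path.append, Assignment.empty_union_empty, walk]⟩
  · rintro ⟨u, l, hl, rfl⟩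
    obtain ⟨v, hv⟩ := exists_tgt_walk u l
    refine ⟨_, ⟨_, ⟨u, rfl⟩, _, ⟨u, l, hl, rfl⟩, rfl, Assignment.empty_unify _, rfl⟩,
      _, ⟨v, rfl⟩, ?_, Assignment.unify_empty _, ?_⟩
    · exact hv
    · simp [Path.append, Assignment.empty_union_empty, walk]

theorem sem_walkQuery (k : ℕ) :
    (walkQuery k).sem twoNodeGraph =
      {A | ∃ u l, l.length = k ∧ A = ([walk u l], Assignment.empty)} := by
  ext A
  simp only [walkQuery, Query.sem, Restrictor.restrict, onlyShortest, sem_walkPattern,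
    Set.mem_ofPred_eq]
  constructor
  · rintro ⟨_, ⟨⟨u, l, hl, rfl⟩, -⟩, rfl⟩
    exact ⟨u, l, hl, rfl⟩
  · rintro ⟨u, l, hl, rfl⟩
    refine ⟨_, ⟨⟨u, l, hl, rfl⟩, ?_⟩, rfl⟩
    rintro _ ⟨v, l', hl', rfl⟩ - -
    -- All matches have length `k`, so each is shortest between its endpoints.
    simp [len_walk, hl, hl']

theorem ncard_walkPaths (k : ℕ) : (walkPaths k).ncard = 2 ^ (k + 1) := by
  have h : walkPaths k =
      Set.range fun x : Bool × List.Vector Bool k => [walk x.1 x.2.1] := by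
    ext P
    simp only [walkPaths, sem_walkQuery, Set.mem_ofPred_eq, Set.mem_range]
    constructor
    · rintro ⟨μ, u, l, hl, h⟩
      exact ⟨(u, ⟨l, hl⟩), (congrArg Prod.fst h).symm⟩
    · rintro ⟨⟨u, l, hl⟩, rfl⟩
      exact ⟨_, u, l, hl, rfl⟩
  have hinj : Function.Injective fun x : Bool × List.Vector Bool k => [walk x.1 x.2.1] := by
    rintro ⟨u, l⟩ ⟨u', l'⟩ h
    have := @walk_injective (u, l.1) (u', l'.1) (List.singleton_inj.mp h)
    simp only [Prod.mk.injEq] at this ⊢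
    exact ⟨this.1, Subtype.ext this.2⟩
  rw [h, ← Set.image_univ, Set.ncard_image_of_injective _ hinj, Set.ncard_univ,
    Nat.card_eq_fintype_card, Fintype.card_prod, card_vector, Fintype.card_bool, pow_succ']

theorem wellTyped_walkQuery (k : ℕ) : (walkQuery k).WellTyped := by
  intro x hx
  simp [walkQuery, Query.vars, Pattern.vars] at hx

theorem walkInputs_subset_allInputs : walkInputs ⊆ allInputs := by
  rintro _ ⟨k, rfl⟩
  exact wellTyped_walkQuery k

/-! ### Sizes -/

/-- The two bounds of the repetition cost `k.size` bits each; everything else is independent of `k`.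
-/
theorem inputSize_walkQuery (k : ℕ) :
    inputSize twoNodeGraph (walkQuery k) = inputSize twoNodeGraph (walkQuery 0) + 2 * k.size := by
  have h : boundSize (k : ℕ∞) = numSize k := by simp [boundSize]
  have h0 : boundSize ((0 : ℕ) : ℕ∞) = numSize 0 := by simp [boundSize]
  simp only [inputSize, walkQuery, Query.size, Pattern.size, h, h0, numSize, Nat.size_zero]
  omega

/-- The leading bit gives `2 ^ (k.size - 1) ≤ k` for positive `k`; the summand `1` covers `k = 0`.
-/
theorem two_pow_size_le (k : ℕ) : 2 ^ k.size ≤ 2 * k + 1 := by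
  rcases Nat.eq_zero_or_pos k with rfl | hk
  · simp
  · obtain ⟨m, hm⟩ : ∃ m, k.size = m + 1 := Nat.exists_eq_succ_of_ne_zero
      (Nat.size_pos.mpr hk).ne'
    have := Nat.lt_size.mp (show m < k.size by omega)
    rw [hm, pow_succ]
    omega

theorem exists_forall_two_pow_two_pow_le_ncard :
    ∃ c : ℕ, 0 < c ∧ ∀ k : ℕ,
      2 ^ 2 ^ (inputSize twoNodeGraph (walkQuery k) / c) ≤ (walkPaths k).ncard := by
  -- With `C` the input size at `k = 0` and `k.size = m + 1`, this divisor satisfies `C + 2 * (m +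
  -- 1) < (m + 1) * (C + 3)`. The quotient is then at most `m`, and `2 ^ m ≤ k + 1`.
  refine ⟨inputSize twoNodeGraph (walkQuery 0) + 3, by omega, fun k => ?_⟩
  rw [ncard_walkPaths, inputSize_walkQuery]
  generalize inputSize twoNodeGraph (walkQuery 0) = C
  refine Nat.pow_le_pow_right (by norm_num) ?_
  have hk := two_pow_size_le k
  rcases hm : k.size with _ | m
  · rw [Nat.div_eq_of_lt (by omega)]
    omega
  · rw [hm, pow_succ] at hk
    have : (C + 2 * (m + 1)) / (C + 3) ≤ m := by
      rw [← Nat.lt_succ_iff, Nat.div_lt_iff_lt_mul (by omega)]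
      nlinarith
    have := Nat.pow_le_pow_right (n := 2) (by norm_num) this
    omega

/-! ### Machines with bounded space -/

namespace Machine

variable {Γ Δ : Type} (M : Machine Γ Δ)

/-- The configurations without the output tape. -/
abbrev Core : Type :=
  M.State × ℕ × (Fin M.numTapes → ℕ → M.Work) × (Fin M.numTapes → ℕ)

def Cfg.core {M : Machine Γ Δ} (c : M.Cfg) : M.Core := (c.state, c.inputPos, c.work, c.workPos)

/-- The configuration after `n` steps, if the machine has not halted before. -/
def run (w : List Γ) : ℕ → Option M.Cfg
  | 0 => some M.init
  | n + 1 => (run w n).bind (M.step w)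

variable {M} {w : List Γ}

/-! ### Determinism and halting -/

theorem exists_run_of_reaches {c : M.Cfg} (h : M.Reaches w c) : ∃ n, M.run w n = some c := by
  induction h with
  | refl => exact ⟨0, rfl⟩
  | tail _ hs ih =>
    obtain ⟨n, hn⟩ := ih
    exact ⟨n + 1, by rw [run, hn]; exact hs⟩

theorem reaches_of_run {n : ℕ} {c : M.Cfg} (h : M.run w n = some c) : M.Reaches w c := by
  induction n generalizing c with
  | zero =>
    obtain rfl := Option.some.inj h
    exact .refl
  | succ n ih =>
    obtain ⟨c', hc', hs⟩ := Option.bind_eq_some_iff.mp h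
    exact .tail (ih hc') hs

theorem length_output_run {n : ℕ} {c : M.Cfg} (h : M.run w n = some c) :
    c.output.length ≤ n := by
  induction n generalizing c with
  | zero =>
    obtain rfl := Option.some.inj h
    simp [init]
  | succ n ih =>
    obtain ⟨c', hc', hs⟩ := Option.bind_eq_some_iff.mp h
    obtain ⟨a, -, rfl⟩ := Option.map_eq_some_iff.mp hs
    have := ih hc'
    have ha : a.output.toList.length ≤ 1 := by cases a.output <;> simp
    simp only [List.length_append]
    omega

/-- The transition function never reads the output tape, so the core decides both whether the
machine halts and what the next core is. -/
theorem map_core_step {c c' : M.Cfg} (h : c.core = c'.core) :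
    (M.step w c).map Cfg.core = (M.step w c').map Cfg.core := by
  obtain ⟨q, i, t, j, o⟩ := c
  obtain ⟨q', i', t', j', o'⟩ := c'
  simp only [Cfg.core, Prod.mk.injEq] at h
  obtain ⟨rfl, rfl, rfl, rfl⟩ := h
  simp only [step, Option.map_map]
  rfl

theorem map_core_run_add {i j : ℕ} (h : (M.run w i).map Cfg.core = (M.run w j).map Cfg.core)
    (n : ℕ) : (M.run w (i + n)).map Cfg.core = (M.run w (j + n)).map Cfg.core := by
  induction n with
  | zero => exact h
  | succ n ih =>
    rw [← add_assoc, ← add_assoc, run, run]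
    rcases hi : M.run w (i + n) with _ | c <;> rcases hj : M.run w (j + n) with _ | c' <;>
      rw [hi, hj] at ih
    · simp at ih
    · simp at ih
    · exact map_core_step (Option.some.inj ih)

theorem run_isSome_of_le {i n : ℕ} (h : (M.run w n).isSome) (hi : i ≤ n) :
    (M.run w i).isSome := by
  induction n, hi using Nat.le_induction with
  | base => exact h
  | succ n _ ih =>
    refine ih ?_
    rw [run] at h
    cases hn : M.run w n with
    | none => simp [hn] at h
    | some c => rfl

/-- A halting computation does not repeat a configuration, even up to output. -/
theorem core_run_injOn {n : ℕ} {c : M.Cfg} (hn : M.run w n = some c) (hc : M.step w c = none) :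
    Set.InjOn (fun i => (M.run w i).map Cfg.core) (Set.Iic n) := by
  have hnone : M.run w (n + 1) = none := by rw [run, hn]; exact hc
  have key : ∀ i j, i < j → j ≤ n →
      (M.run w i).map Cfg.core ≠ (M.run w j).map Cfg.core := by
    intro i j hij hj h
    -- This shift takes time `j` to `n + 1`, when the run is over, but the earlier time `i` to at
    -- most `n`, when it is still defined.
    have := map_core_run_add h (n + 1 - j)
    rw [show j + (n + 1 - j) = n + 1 by omega, hnone, Option.map_none, Option.map_eq_none_iff]
      at this
    have h' := run_isSome_of_le (M := M) (w := w) (n := n) (i := i + (n + 1 - j)) (by simp [hn])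
      (by omega)
    simp [this] at h'
  intro i hi j hj h
  rcases lt_trichotomy i j with hij | hij | hij
  · exact absurd h (key i j hij hj)
  · exact hij
  · exact absurd h.symm (key j i hij hi)

/-! ### Counting configurations in bounded space -/

theorem inputPos_le_of_reaches {c : M.Cfg} (h : M.Reaches w c) : c.inputPos ≤ w.length + 1 := by
  induction h with
  | refl => exact Nat.zero_le _
  | tail _ hs _ =>
    obtain ⟨a, -, rfl⟩ := Option.map_eq_some_iff.mp hs
    exact min_le_right _ _

/-- A cell changes only under the head, and the heads stay below `s`. Thus the first `s` cells
determine the whole tape. -/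
theorem work_eq_blank_of_reaches {s : ℕ} (hs : M.RunsInSpace w s) {c : M.Cfg}
    (h : M.Reaches w c) (j : Fin M.numTapes) {i : ℕ} (hi : s ≤ i) : c.work j i = M.blank := by
  induction h with
  | refl => rfl
  | tail hr hstep ih =>
    obtain ⟨a, -, rfl⟩ := Option.map_eq_some_iff.mp hstep
    have := hs _ hr j
    simp only
    rw [Function.update_of_ne (by omega), ih]

/-- The part of a configuration that matters if the input has length `n` and the space is
bounded by `s`. -/
abbrev BoundedCore (M : Machine Γ Δ) (n s : ℕ) : Type :=
  M.State × Fin (n + 2) × (Fin M.numTapes → Fin s → M.Work) × (Fin M.numTapes → Fin s)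

/-- In a halting computation in space `s`, the output is no longer than the number of
configurations. -/
theorem length_le_card_boundedCore {s : ℕ} {o : List Δ} (hs : M.RunsInSpace w s)
    (h : M.HaltsWithOutput w o) : o.length ≤ Nat.card (M.BoundedCore w.length s) := by
  obtain ⟨c, hreach, hhalt, rfl⟩ := h
  obtain ⟨n, hn⟩ := exists_run_of_reaches hreach
  have hinj := core_run_injOn hn hhalt
  -- The times `0, …, n - 1` suffice, since `n` steps write at most `n` symbols.
  have hsome : ∀ i : Fin n, ∃ c, M.run w i = some c := fun i =>
    Option.isSome_iff_exists.mp (run_isSome_of_le (by simp [hn]) i.2.le)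
  choose cfg hcfg using hsome
  have hr := fun i => reaches_of_run (hcfg i)
  let f : Fin n → M.BoundedCore w.length s := fun i =>
    ((cfg i).state, ⟨(cfg i).inputPos, Nat.lt_succ_of_le (inputPos_le_of_reaches (hr i))⟩,
      fun j x => (cfg i).work j x, fun j => ⟨(cfg i).workPos j, hs _ (hr i) j⟩)
  have hf : Function.Injective f := by
    intro i i' h
    simp only [f, Prod.mk.injEq, Fin.mk.injEq] at h
    obtain ⟨h₁, h₂, h₃, h₄⟩ := h
    -- Cores at different times differ, so it remains to recover the full core from its bounded
    -- part.
    refine Fin.ext (hinj i.2.le i'.2.le ?_)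
    simp only [hcfg, Option.map_some, Cfg.core, Option.some.injEq, Prod.mk.injEq]
    refine ⟨h₁, h₂, ?_, ?_⟩
    · funext j x
      by_cases hx : x < s
      · exact congrFun (congrFun h₃ j) ⟨x, hx⟩
      · rw [work_eq_blank_of_reaches hs (hr i) j (not_lt.mp hx),
          work_eq_blank_of_reaches hs (hr i') j (not_lt.mp hx)]
    · funext j
      exact congrArg Fin.val (congrFun h₄ j)
  have := M.finite_state
  have := M.finite_work
  calc c.output.length ≤ n := length_output_run hn
    _ = Nat.card (Fin n) := by simp
    _ ≤ _ := Nat.card_le_card_of_injective f hf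

/-- Every factor and every base is estimated by `x ≤ 2 ^ x`. This is crude, but for a fixed machine
the exponent is polynomial in `n` and `s`. -/
theorem card_boundedCore_le (M : Machine Γ Δ) (n s : ℕ) :
    Nat.card (M.BoundedCore n s) ≤
      2 ^ (Nat.card M.State + (n + 2) + Nat.card M.Work * s * M.numTapes + s * M.numTapes) := by
  have := M.finite_state
  have := M.finite_work
  simp only [Nat.card_prod, Nat.card_fun, Nat.card_fin]
  rw [pow_add 2 (_ + _), pow_add 2 (_ + _), pow_add 2 (Nat.card M.State), pow_mul 2 (_ * _),
    pow_mul 2 (Nat.card M.Work), pow_mul 2 s, ← mul_assoc, ← mul_assoc]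
  gcongr
  all_goals exact Nat.lt_two_pow_self.le

end Machine

/-! ### The lower bound -/

theorem exists_eval_lt_two_pow (p : Polynomial ℕ) : ∃ m : ℕ, p.eval m < 2 ^ m := by
  have h : (fun m : ℕ => ((p.eval m : ℕ) : ℝ)) =o[Filter.atTop] fun m : ℕ => (2 : ℝ) ^ m := by
    induction p using Polynomial.induction_on' with
    | add p q hp hq =>
      simp only [Polynomial.eval_add, Nat.cast_add]
      exact hp.add hq
    | monomial n a =>
      simp only [Polynomial.eval_monomial, Nat.cast_mul, Nat.cast_pow]
      exact (isLittleO_pow_const_const_pow_of_one_lt n one_lt_two).const_mul_left _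
  -- The factor `1 / 2` turns the non-strict asymptotic bound into a strict one.
  obtain ⟨m, hm⟩ := (h.bound (show (0 : ℝ) < 1 / 2 by norm_num)).exists
  refine ⟨m, ?_⟩
  rw [Real.norm_of_nonneg (by positivity), Real.norm_of_nonneg (by positivity)] at hm
  have hpos : (0 : ℝ) < 2 ^ m := by positivity
  have : ((p.eval m : ℕ) : ℝ) < 2 ^ m := by linarith
  exact_mod_cast this

/-- The separator alone gives each answer one symbol, however short its code word is. -/
theorem length_le_length_outputWord {Δ : Type} (encodeAnswer : Answer → List Δ)
    (l : List Answer) : l.length ≤ (outputWord encodeAnswer l).length := by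
  induction l with
  | nil => simp
  | cons A l ih =>
    simp only [outputWord, List.flatMap_cons, List.length_append, List.length_cons,
      List.length_nil] at ih ⊢
    omega

/-- Distinct paths need distinct list entries, so the count of paths bounds the list length from
below. -/
theorem two_pow_le_length_answers {k : ℕ} {l : List Answer}
    (hl : ∀ A, A ∈ l ↔ A ∈ (walkQuery k).sem twoNodeGraph) : 2 ^ (k + 1) ≤ l.length := by
  classical
  have h : walkPaths k ⊆ ((l.map Prod.fst).toFinset : Set (List Path)) := by
    rintro P ⟨μ, h⟩
    simpa using ⟨μ, (hl _).mpr h⟩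
  rw [← ncard_walkPaths]
  calc _ ≤ _ := Set.ncard_le_ncard h (Finset.finite_toSet _)
    _ = _ := Set.ncard_coe_finset _
    _ ≤ _ := List.toFinset_card_le _
    _ = _ := List.length_map _

theorem not_polynomialSpaceOn_walkInputs {Γ Δ : Type} (enc : InputEncoding Γ)
    (encodeAnswer : Answer → List Δ) (M : Machine Γ (Option Δ))
    (hM : EnumeratesOn walkInputs enc encodeAnswer M) : ¬ PolynomialSpaceOn walkInputs enc M := by
  rintro ⟨p, hp⟩
  obtain ⟨q, hq⟩ := enc.length_le
  have hbound : ∀ k, 2 ^ (k + 1) ≤ 2 ^ (Nat.card M.State +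
      (q.eval (inputSize twoNodeGraph (walkQuery k)) + 2) +
      Nat.card M.Work * p.eval (inputSize twoNodeGraph (walkQuery k)) * M.numTapes +
      p.eval (inputSize twoNodeGraph (walkQuery k)) * M.numTapes) := by
    intro k
    obtain ⟨l, -, hl, hhalt⟩ := hM twoNodeGraph (walkQuery k) ⟨k, rfl⟩
    calc 2 ^ (k + 1) ≤ l.length := two_pow_le_length_answers hl
      _ ≤ _ := length_le_length_outputWord encodeAnswer l
      _ ≤ _ := Machine.length_le_card_boundedCore (hp _ _ ⟨k, rfl⟩) hhalt
      _ ≤ _ := M.card_boundedCore_le _ _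
      _ ≤ _ := Nat.pow_le_pow_right two_pos (by gcongr; exact hq _ _)
  open Polynomial in
  -- Since `2 ^ m` has `m + 1` bits, `r` is the input size for `k = 2 ^ m` as a polynomial in `m`;
  -- `R` below is the resulting exponent in `hbound`.
  let r : ℕ[X] := Polynomial.C (inputSize twoNodeGraph (walkQuery 0) + 2) + 2 * X
  open Polynomial in
  let R : ℕ[X] := Polynomial.C (Nat.card M.State) + (q.comp r + 2) +
    Polynomial.C (Nat.card M.Work) * p.comp r * Polynomial.C M.numTapes +
    p.comp r * Polynomial.C M.numTapes
  obtain ⟨m, hm⟩ := exists_eval_lt_two_pow R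
  have hr : inputSize twoNodeGraph (walkQuery (2 ^ m)) = r.eval m := by
    rw [inputSize_walkQuery, Nat.size_pow]
    simp [r]
    ring
  -- Comparing exponents gives `2 ^ m + 1 ≤ R(m)`, against the choice of `m`.
  have := (Nat.pow_le_pow_iff_right (by norm_num)).mp (hbound (2 ^ m))
  rw [hr] at this
  simp [R] at hm
  omega

end GPC

theorem mainTheorem4 :
    (∀ (Γ Δ : Type) [Finite Γ] [Finite Δ] (enc : GPC.InputEncoding Γ)
        (encodeAnswer : GPC.Answer → List Δ), Function.Injective encodeAnswer →
      (¬ ∃ M : GPC.Machine Γ (Option Δ),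
        GPC.EnumeratesOn GPC.allInputs enc encodeAnswer M ∧
        GPC.PolynomialSpaceOn GPC.allInputs enc M) ∧
      (¬ ∃ M : GPC.Machine Γ (Option Δ),
        GPC.EnumeratesOn GPC.walkInputs enc encodeAnswer M ∧
        GPC.PolynomialSpaceOn GPC.walkInputs enc M)) ∧
    (∀ k : ℕ, (GPC.walkQuery k).WellTyped ∧ (GPC.walkPaths k).ncard = 2 ^ (k + 1)) ∧
    ∃ c : ℕ, 0 < c ∧ ∀ k : ℕ,
      2 ^ 2 ^ (GPC.inputSize GPC.twoNodeGraph (GPC.walkQuery k) / c) ≤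
        (GPC.walkPaths k).ncard := by
  refine ⟨fun Γ Δ _ _ enc encodeAnswer _ => ⟨?_, ?_⟩,
    fun k => ⟨GPC.wellTyped_walkQuery k, GPC.ncard_walkPaths k⟩,
    GPC.exists_forall_two_pow_two_pow_le_ncard⟩
  -- The walk queries are well-typed, so a machine for all inputs is in particular one for
  -- `walkInputs`, with the same polynomial.
  · rintro ⟨M, hM, p, hp⟩
    exact GPC.not_polynomialSpaceOn_walkInputs enc encodeAnswer M
      (fun G Q h => hM G Q (GPC.walkInputs_subset_allInputs h))
      ⟨p, fun G Q h => hp G Q (GPC.walkInputs_subset_allInputs h)⟩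
  · rintro ⟨M, hM, hp⟩
    exact GPC.not_polynomialSpaceOn_walkInputs enc encodeAnswer M hM hp
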